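/- Let $\mathcal H$ be a complex Hilbert space and let $(S(t))_{t\ge 0}$ be a strongly continuous semigroup of bounded operators on $\mathcal H$ with $S(0)=I$ and generator $A$. Let $\omega\in\mathbb R$ be such that the closed half-plane $\{\operatorname{Re} z\ge\omega\}$ is contained in the resolvent set of $A$ and $\|(z-A)^{-1}\|$ is uniformly bounded there, and define $r(\omega)$ by $$\frac1{r(\omega)}=\sup_{\operatorname{Re} z>\omega}\|(z-A)^{-1}\| .$$ Let $m:[0,\infty)\to(0,\infty)$ be continuous with $\|S(t)\|\le m(t)$ for all $t\ge 0$. For $c>0$ write $$\Big\|\frac1m\Big\|_{e^{-\omega\cdot}L^2(0,c)}=\Big(\int_0^c \frac{e^{2\omega s}}{m(s)^2}\,ds\Big)^{1/2}.$$ Then for all $a,b>0$ and all $t>a+b$, $$\|S(t)\|\le \frac{e^{\omega t-r(\omega)(t-a-b)}}{r(\omega)\,\big\|\frac1m\big\|_{e^{-\omega\cdot}L^2(0,a)}\,\big\|\frac1m\big\|_{e^{-\omega\cdot}L^2(0,b)}} .$$ In particular, if $\omega=0$ and $m=1$, then $\|S(t)\|\le 2e\cdot e^{-r(0)t}$ for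 all $t\ge 0$. -/

import Mathlib

open Set Filter Topology MeasureTheory

noncomputable section

namespace SemigroupBounds

variable {H : Type*} [NormedAddCommGroup H] [InnerProductSpace ℂ H]

/-- `S : [0, ∞) → L(H)` is a strongly continuous semigroup with `S 0 = I`.
The family is indexed by `ℝ`, but only its values at times `t ≥ 0` are ever used. -/
structure IsC0Semigroup (S : ℝ → H →L[ℂ] H) : Prop where
  map_zero : S 0 = ContinuousLinearMap.id ℂ H
  map_add : ∀ s t : ℝ, 0 ≤ s → 0 ≤ t → S (s + t) = (S s).comp (S t)
  strongly_continuous : ∀ x : H, ContinuousOn (fun t : ℝ => S t x) (Ici 0)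

/-- The right difference quotient `h⁻¹ (S(h) x - x)`. -/
def diffQuot (S : ℝ → H →L[ℂ] H) (x : H) (h : ℝ) : H :=
  ((h⁻¹ : ℝ) : ℂ) • (S h x - x)

/-- The domain of the generator: all `x` for which `lim_{h → 0+} h⁻¹ (S(h) x - x)` exists. -/
def generatorDomain (S : ℝ → H →L[ℂ] H) : Submodule ℂ H where
  carrier := {x | ∃ y : H, Tendsto (diffQuot S x) (𝓝[>] 0) (𝓝 y)}
  add_mem' := by
    rintro x₁ x₂ ⟨y₁, h₁⟩ ⟨y₂, h₂⟩
    refine ⟨y₁ + y₂, (h₁.add h₂).congr fun h => ?_⟩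
    simp only [diffQuot, map_add]
    module
  zero_mem' := ⟨0, tendsto_const_nhds.congr fun h => by simp [diffQuot]⟩
  smul_mem' := by
    rintro c x ⟨y, hy⟩
    refine ⟨c • y, (hy.const_smul c).congr fun h => ?_⟩
    simp only [diffQuot, map_smul]
    module

/-- The (in general unbounded) generator `A` of the semigroup `S`:
`A x = lim_{h → 0+} h⁻¹ (S(h) x - x)` on the domain where this limit exists. -/
def generator (S : ℝ → H →L[ℂ] H) : H →ₗ.[ℂ] H where
  domain := generatorDomain S
  toFun :=
    { toFun := fun x => Classical.choose x.2
      map_add' := fun x₁ x₂ => by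
        refine tendsto_nhds_unique (Classical.choose_spec (x₁ + x₂).2)
          (((Classical.choose_spec x₁.2).add (Classical.choose_spec x₂.2)).congr fun h => ?_)
        simp only [diffQuot, Submodule.coe_add, map_add]
        module
      map_smul' := fun c x => by
        refine tendsto_nhds_unique (Classical.choose_spec (c • x).2)
          (((Classical.choose_spec x.2).const_smul c).congr fun h => ?_)
        simp only [diffQuot, Submodule.coe_smul, map_smul]
        module }

theorem generator_spec (S : ℝ → H →L[ℂ] H) (x : (generator S).domain) :
    Tendsto (diffQuot S (x : H)) (𝓝[>] 0) (𝓝 (generator S x)) :=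
  Classical.choose_spec x.2

/-- `R` is a bounded everywhere defined two-sided inverse of `z - A : D(A) → H`. -/
def IsResolventAt (A : H →ₗ.[ℂ] H) (z : ℂ) (R : H →L[ℂ] H) : Prop :=
  (∀ y : H, ∃ hy : R y ∈ A.domain, z • R y - A ⟨R y, hy⟩ = y) ∧
    ∀ x : A.domain, R (z • (x : H) - A x) = x

theorem IsResolventAt.unique {A : H →ₗ.[ℂ] H} {z : ℂ} {R R' : H →L[ℂ] H}
    (h : IsResolventAt A z R) (h' : IsResolventAt A z R') : R = R' := by
  ext y
  obtain ⟨hy, e⟩ := h'.1 y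
  have := h.2 ⟨R' y, hy⟩
  rwa [e] at this

/-- The resolvent set `ρ(A)` of an unbounded operator `A`. -/
def resolventSetOf (A : H →ₗ.[ℂ] H) : Set ℂ :=
  {z | ∃ R : H →L[ℂ] H, IsResolventAt A z R}

open scoped Classical in
/-- The resolvent `(z - A)⁻¹` for `z ∈ ρ(A)` (and `0` off the resolvent set). -/
def resolventOf (A : H →ₗ.[ℂ] H) (z : ℂ) : H →L[ℂ] H :=
  if h : z ∈ resolventSetOf A then Classical.choose h else 0

theorem resolventOf_spec {A : H →ₗ.[ℂ] H} {z : ℂ} (h : z ∈ resolventSetOf A) :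
    IsResolventAt A z (resolventOf A z) := by
  rw [resolventOf, dif_pos h]
  exact Classical.choose_spec h

/-- The resolvent of `A` exists and is uniformly bounded in the half-plane `Re z ≥ ω`. -/
def ResolventBoundedOn (A : H →ₗ.[ℂ] H) (ω : ℝ) : Prop :=
  (∀ z : ℂ, ω ≤ z.re → z ∈ resolventSetOf A) ∧
    ∃ C : ℝ, ∀ z : ℂ, ω ≤ z.re → ‖resolventOf A z‖ ≤ C

/-- The number `r(ω)` with `1 / r(ω) = sup_{Re z > ω} ‖(z - A)⁻¹‖`. -/
def rOf (A : H →ₗ.[ℂ] H) (ω : ℝ) : ℝ :=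
  (sSup ((fun z : ℂ => ‖resolventOf A z‖) '' {z : ℂ | ω < z.re}))⁻¹

/-- The norm of `f` in `e^{-ω·} L²(0, a)`, that is `‖e^{ω·} f‖_{L²(0, a)}`. -/
def weightedL2Norm (ω a : ℝ) (f : ℝ → ℝ) : ℝ :=
  (eLpNorm (fun s : ℝ => Real.exp (ω * s) * f s) 2 (volume.restrict (Ioo 0 a))).toReal

end SemigroupBounds

end

/-! Fix `x` and cut the orbit off by a bounded Lipschitz `Φ` vanishing on the negative axis. Then `Φ
S(·)x` solves `u' = A u + Φ' S(·)x` with zero initial value, so its Laplace transform is the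
resolvent applied to that of `Φ' S(·)x` (`laplace_cutoff_orbit`). On a line `Re z = μ > ω` the
resolvent is bounded by `N`, and Plancherel gives `∫ Φ² w ≤ N² ∫ Φ'² w` with `w s = (e^{-μs} ‖S s
x‖)²` (`integral_cutoff_sq_le`). Let `Φ` rise from 0 to 1 on `[0, a]`, equal `e^{(s-a)/N}` on `[a,
t-b]`, and stay constant afterwards. On the middle interval `Φ = N Φ'`, so its contributions cancel.
What remains bounds the energy on `(t-b, t)`, multiplied by `e^{2(t-a-b)/N}`, by `N²` times a source
on `(0, a)`. Both ends are compared with pointwise norms through `‖S s‖ ≤ m s` (`orbit_le_of_lt`),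
and `μ ↓ ω` finishes the argument. The energy inequality presupposes `w` integrable. This is known
for large `μ` from exponential growth and is carried down to `ω` in steps of a fixed size depending
only on `N` (`integrableOn_sq_descend`, `integrableOn_sq_abscissa`). -/

noncomputable section

namespace SemigroupBounds

/-! ### Plancherel's theorem for Hilbert-space-valued functions in `L¹ ∩ L²`. -/

section Plancherel

open FourierTransform SchwartzMap
open scoped ContDiff

variable {F : Type*} [NormedAddCommGroup F] [InnerProductSpace ℂ F] [CompleteSpace F]

/-- The `L²` Fourier transform of an `L¹ ∩ L²` function is given by the Fourier integral. -/
theorem fourier_toLp_ae_eq {f : ℝ → F} (h1 : Integrable f) (h2 : MemLp f 2) :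
    (𝓕 (h2.toLp f) : Lp F 2 (volume : Measure ℝ)) =ᵐ[volume] 𝓕 f := by
  have hcont : Continuous (𝓕 f) :=
    VectorFourier.fourierIntegral_continuous Real.continuous_fourierChar
      (by exact (innerSL ℝ).continuous₂) h1
  refine ae_eq_of_integral_contDiff_smul_eq ?_ hcont.locallyIntegrable ?_
  · exact (Lp.memLp _).locallyIntegrable (by norm_num)
  intro g hg hgs
  have hgc : HasCompactSupport (fun x => (g x : ℂ)) := hgs.comp_left (g := fun x : ℝ => (x : ℂ)) (by simp)
  let G : 𝓢(ℝ, ℂ) := hgc.toSchwartzMap (Complex.ofRealCLM.contDiff.comp hg)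
  have hG : ∀ x, G x = (g x : ℂ) := fun x => rfl
  -- The `L²` transform acts on test functions by duality; the multiplication formula for integrable
  -- functions moves the transform from `G` back to `f`.
  have key := congrArg (fun T => T G) (Lp.fourier_toTemperedDistribution_eq (h2.toLp f))
  simp only [TemperedDistribution.fourier_apply, Lp.toTemperedDistribution_apply] at key
  have e1 : ∫ x, (𝓕 G) x • (h2.toLp f) x = ∫ x, (𝓕 (G : ℝ → ℂ)) x • f x := by
    refine integral_congr_ae ?_
    filter_upwards [h2.coeFn_toLp] with x hx
    rw [hx, SchwartzMap.fourier_coe]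
  have e2 := VectorFourier.integral_fourierIntegral_smul_eq_flip (L := innerₗ ℝ) (μ := (volume : Measure ℝ))
    (ν := (volume : Measure ℝ)) Real.continuous_fourierChar (by exact (innerSL ℝ).continuous₂) G.integrable h1
  rw [flip_innerₗ] at e2
  have e3 : ∫ x, (𝓕 (G : ℝ → ℂ)) x • f x = ∫ x, G x • (𝓕 f) x := e2
  rw [e1, e3] at key
  simp only [hG, Complex.coe_smul] at key
  exact key.symm

theorem eLpNorm_fourier_eq {f : ℝ → F} (h1 : Integrable f) (h2 : MemLp f 2) :
    eLpNorm (𝓕 f) 2 = eLpNorm f 2 := by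
  rw [← eLpNorm_congr_ae (fourier_toLp_ae_eq h1 h2), ← eLpNorm_congr_ae h2.coeFn_toLp,
    ← Lp.enorm_def, ← Lp.enorm_def, ← ofReal_norm, ← ofReal_norm, Lp.norm_fourier_eq]

end Plancherel

/-! ### Laplace transforms of cut-off orbits. -/

variable {H : Type*} [NormedAddCommGroup H] [InnerProductSpace ℂ H]

theorem IsC0Semigroup.aestronglyMeasurable {S : ℝ → H →L[ℂ] H} (hS : IsC0Semigroup S) (x : H) :
    AEStronglyMeasurable (fun t => S t x) (volume.restrict (Ioi 0)) :=
  ((hS.strongly_continuous x).mono Ioi_subset_Ici_self).aestronglyMeasurable measurableSet_Ioi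

theorem generator_eq_of_tendsto {S : ℝ → H →L[ℂ] H} {x y : H}
    (h : Tendsto (diffQuot S x) (𝓝[>] 0) (𝓝 y)) :
    ∃ hx : x ∈ (generator S).domain, generator S ⟨x, hx⟩ = y :=
  ⟨⟨y, h⟩, tendsto_nhds_unique (generator_spec S ⟨x, ⟨y, h⟩⟩) h⟩

/-- The function `e^{-z·} Φ` with complex exponent `z`. -/
def expWeight (z : ℂ) (Φ : ℝ → ℝ) (t : ℝ) : ℂ := Complex.exp (-z * t) * Φ t

theorem norm_exp_neg_mul (z : ℂ) (t : ℝ) : ‖Complex.exp (-z * t)‖ = Real.exp (-z.re * t) := by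
  simp [Complex.norm_exp]

theorem integrableOn_expWeight [CompleteSpace H] {S : ℝ → H →L[ℂ] H} (hS : IsC0Semigroup S) (x : H) {z : ℂ}
    (hint : IntegrableOn (fun t => Real.exp (-z.re * t) * ‖S t x‖) (Ioi 0))
    {Φ : ℝ → ℝ} {M : ℝ} (hΦ : Measurable Φ) (hM : ∀ t, |Φ t| ≤ M) :
    IntegrableOn (fun t => expWeight z Φ t • S t x) (Ioi 0) := by
  refine (hint.const_mul M).mono' ?_ (ae_of_all _ fun t => ?_)
  · refine AEStronglyMeasurable.smul ?_ (hS.aestronglyMeasurable x)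
    unfold expWeight
    fun_prop
  · rw [norm_smul, expWeight, norm_mul, norm_exp_neg_mul, Complex.norm_real, Real.norm_eq_abs]
    calc _ = |Φ t| * (Real.exp (-z.re * t) * ‖S t x‖) := by ring
      _ ≤ _ := by gcongr; exact hM t

/-- After division by `h` the bound no longer depends on `h`: it is the dominating function for the
difference quotients in `laplace_cutoff_orbit`. -/
theorem norm_expWeight_sub_le {z : ℂ} {Φ : ℝ → ℝ} {K : NNReal} {M : ℝ} (hK : LipschitzWith K Φ)
    (hM : ∀ t, |Φ t| ≤ M) {h : ℝ} (h0 : 0 < h) (h1 : ‖z‖ * h ≤ 1) (t : ℝ) :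
    ‖expWeight z Φ (t - h) - expWeight z Φ t‖ ≤ h * ((2 * ‖z‖ * M + K) * Real.exp (-z.re * t)) := by
  have e : expWeight z Φ (t - h) - expWeight z Φ t =
      Complex.exp (-z * t) * ((Complex.exp (z * h) - 1) * Φ (t - h) + ((Φ (t - h) - Φ t : ℝ) : ℂ)) := by
    have : Complex.exp (-z * (t - h : ℝ)) = Complex.exp (-z * t) * Complex.exp (z * h) := by
      rw [← Complex.exp_add]; congr 1; push_cast; ring
    rw [expWeight, expWeight, this]; push_cast; ring
  have hz : ‖z * h‖ = ‖z‖ * h := by simp [abs_of_pos h0]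
  have e1 : ‖Complex.exp (z * h) - 1‖ ≤ 2 * (‖z‖ * h) := by
    rw [← hz]; exact Complex.norm_exp_sub_one_le (hz ▸ h1)
  have e2 : |Φ (t - h) - Φ t| ≤ K * h := by
    have := hK.dist_le_mul (t - h) t
    simpa [Real.dist_eq, abs_of_pos h0] using this
  rw [e, norm_mul, norm_exp_neg_mul]
  have e3 : ‖(Complex.exp (z * h) - 1) * Φ (t - h) + ((Φ (t - h) - Φ t : ℝ) : ℂ)‖
      ≤ 2 * (‖z‖ * h) * M + K * h := by
    refine (norm_add_le _ _).trans (add_le_add ?_ ?_)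
    · rw [norm_mul, Complex.norm_real, Real.norm_eq_abs]
      exact mul_le_mul e1 (hM _) (abs_nonneg _) (by positivity)
    · rwa [Complex.norm_real, Real.norm_eq_abs]
  calc _ ≤ Real.exp (-z.re * t) * (2 * (‖z‖ * h) * M + K * h) := by gcongr
    _ = _ := by ring

theorem hasDerivAt_expWeight {z : ℂ} {Φ : ℝ → ℝ} {t : ℝ} (h : DifferentiableAt ℝ Φ t) :
    HasDerivAt (expWeight z Φ) (expWeight z (deriv Φ) t - z * expWeight z Φ t) t := by
  have h1 : HasDerivAt (fun s : ℝ => Complex.exp (-z * s)) (Complex.exp (-z * t) * (-z * 1)) t :=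
    ((Complex.ofRealCLM.hasDerivAt (x := t)).const_mul (-z)).cexp
  convert! h1.mul h.hasDerivAt.ofReal_comp using 1
  simp only [expWeight]; ring

/-- Multiplying the orbit of `x` by a bounded Lipschitz cutoff `Φ` gives a solution of the
inhomogeneous equation with source `Φ' S(·) x`; this is its Laplace transform. -/
theorem laplace_cutoff_orbit [CompleteSpace H] {S : ℝ → H →L[ℂ] H} (hS : IsC0Semigroup S) (x : H)
    {z : ℂ} (hz : z ∈ resolventSetOf (generator S))
    (hint : IntegrableOn (fun t => Real.exp (-z.re * t) * ‖S t x‖) (Ioi 0))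
    {Φ : ℝ → ℝ} {K : NNReal} {M : ℝ} (hK : LipschitzWith K Φ) (hM : ∀ t, |Φ t| ≤ M)
    (h0 : ∀ t ≤ 0, Φ t = 0) :
    ∫ t in Ioi (0 : ℝ), expWeight z Φ t • S t x =
      resolventOf (generator S) z (∫ t in Ioi (0 : ℝ), expWeight z (deriv Φ) t • S t x) := by
  have hi1 := integrableOn_expWeight hS x hint hK.continuous.measurable hM
  have hi2 := integrableOn_expWeight hS x hint (measurable_deriv Φ) (M := K)
    (fun t => norm_deriv_le_of_lipschitz hK)
  set v := ∫ t in Ioi (0 : ℝ), expWeight z Φ t • S t x with hv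
  set f := ∫ t in Ioi (0 : ℝ), expWeight z (deriv Φ) t • S t x with hf
  -- By the semigroup law `S h` acts on `v` by translating the cutoff; since `Φ` vanishes for `t ≤
  -- 0`, nothing is lost on `(0, h]`.
  have shift : ∀ h : ℝ, 0 < h →
      IntegrableOn (fun t => expWeight z Φ (t - h) • S t x) (Ioi 0) ∧
      S h v = ∫ t in Ioi (0 : ℝ), expWeight z Φ (t - h) • S t x := by
    intro h hh
    have e0 : (fun t => (Ioi (0 : ℝ)).indicator (fun t => expWeight z Φ (t - h) • S t x) t) =
        fun t => (Ioi (0 : ℝ)).indicator (fun t => S h (expWeight z Φ t • S t x)) (t - h) := by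
      funext t
      by_cases ht : 0 < t - h
      · have ht' : 0 < t := by linarith
        rw [indicator_of_mem (show t ∈ Ioi (0 : ℝ) from ht'),
          indicator_of_mem (show t - h ∈ Ioi (0 : ℝ) from ht), map_smul,
          show S t = (S h).comp (S (t - h)) by
            rw [← hS.map_add h (t - h) hh.le ht.le]; congr 1; ring]
        rfl
      · rw [indicator_of_notMem (show t - h ∉ Ioi (0 : ℝ) from ht)]
        refine indicator_apply_eq_zero.2 fun _ => ?_
        simp [expWeight, h0 _ (not_lt.1 ht)]
    have hi3 : IntegrableOn (fun t => S h (expWeight z Φ t • S t x)) (Ioi 0) :=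
      (S h).integrable_comp hi1
    constructor
    · rw [← integrable_indicator_iff measurableSet_Ioi]
      have := ((integrable_indicator_iff measurableSet_Ioi).2 hi3).comp_sub_right h
      rw [← e0] at this
      exact this
    · rw [hv, ← (S h).integral_comp_comm hi1, ← integral_indicator measurableSet_Ioi,
        ← integral_indicator measurableSet_Ioi]
      exact ((congrArg (fun g : ℝ → H => ∫ t, g t) e0).trans
        (integral_sub_right_eq_self _ h)).symm
  -- This says `v ∈ D(A)` and `A v = z v - f`. It follows by dominated convergence, pointwise almost
  -- everywhere because a Lipschitz `Φ` is differentiable almost everywhere.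
  have lim : Tendsto (diffQuot S v) (𝓝[>] 0) (𝓝 (z • v - f)) := by
    have e1 : z • v - f = ∫ t in Ioi (0 : ℝ),
        (z * expWeight z Φ t - expWeight z (deriv Φ) t) • S t x := by
      rw [hv, hf, ← integral_smul]
      refine (integral_sub (hi1.smul z) hi2).symm.trans ?_
      refine integral_congr_ae (ae_of_all _ fun t => ?_)
      simp only [sub_smul, mul_smul, Pi.smul_apply]
    have e2 : ∀ᶠ h in 𝓝[>] (0 : ℝ), ∫ t in Ioi (0 : ℝ),
        (((h⁻¹ : ℝ) : ℂ) * (expWeight z Φ (t - h) - expWeight z Φ t)) • S t x = diffQuot S v h := by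
      filter_upwards [self_mem_nhdsWithin] with h hh
      rw [diffQuot, (shift h hh).2, hv, ← integral_sub (shift h hh).1 hi1, ← integral_smul]
      refine integral_congr_ae (ae_of_all _ fun t => ?_)
      simp only [sub_smul, mul_smul]
    rw [e1]
    refine Tendsto.congr' e2 ?_
    refine tendsto_integral_filter_of_dominated_convergence
      (fun t => (2 * ‖z‖ * M + K) * (Real.exp (-z.re * t) * ‖S t x‖)) ?_ ?_ (hint.const_mul _) ?_
    · filter_upwards [] with h
      refine AEStronglyMeasurable.smul ?_ (hS.aestronglyMeasurable x)
      have := hK.continuous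
      unfold expWeight
      fun_prop
    · have hsmall : ∀ᶠ h in 𝓝[>] (0 : ℝ), ‖z‖ * h ≤ 1 := by
        have : Tendsto (fun h : ℝ => ‖z‖ * h) (𝓝[>] 0) (𝓝 (‖z‖ * 0)) :=
          (continuous_const.mul continuous_id).continuousWithinAt
        exact (this.eventually (gt_mem_nhds (by simp : ‖z‖ * 0 < 1))).mono fun h hh => le_of_lt hh
      filter_upwards [self_mem_nhdsWithin, hsmall] with h hh hh1
      refine ae_of_all _ fun t => ?_
      have hh0 : 0 < h := hh
      rw [← mul_assoc (_ + _), norm_smul, norm_mul, Complex.norm_real, Real.norm_eq_abs, abs_of_pos (inv_pos.2 hh0)]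
      refine mul_le_mul_of_nonneg_right ?_ (norm_nonneg _)
      rw [inv_mul_le_iff₀ hh0]
      exact norm_expWeight_sub_le hK hM hh0 hh1 t
    · filter_upwards [ae_restrict_of_ae hK.ae_differentiableAt_real] with t ht
      refine Tendsto.smul_const ?_ _
      have d := (hasDerivAt_iff_tendsto_slope_zero.1 (hasDerivAt_expWeight (z := z) ht))
      have hneg : Tendsto (fun h : ℝ => -h) (𝓝[>] 0) (𝓝[≠] 0) := by
        refine tendsto_nhdsWithin_iff.2 ⟨?_, ?_⟩
        · have : Tendsto (fun h : ℝ => -h) (𝓝 0) (𝓝 (-0)) := continuous_neg.tendsto 0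
          rw [neg_zero] at this
          exact this.mono_left nhdsWithin_le_nhds
        · filter_upwards [self_mem_nhdsWithin] with h hh
          have : 0 < h := hh
          simpa using this.ne'
      have := (d.comp hneg).neg
      rw [neg_sub] at this
      refine this.congr fun h => ?_
      simp only [Function.comp, Complex.real_smul, ← sub_eq_add_neg, inv_neg]
      push_cast; ring
  obtain ⟨hmem, hval⟩ := generator_eq_of_tendsto lim
  have := (resolventOf_spec hz).2 ⟨v, hmem⟩
  rw [hval] at this
  simpa using this.symm

/-! ### The energy inequality on a vertical line. -/

theorem toReal_eLpNorm_two_sq {α E : Type*} [MeasurableSpace α] {ν : Measure α}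
    [NormedAddCommGroup E] {f : α → E} (hf : MemLp f 2 ν) :
    (eLpNorm f 2 ν).toReal ^ 2 = ∫ a, ‖f a‖ ^ 2 ∂ν := by
  have h0 : 0 ≤ ∫ a, ‖f a‖ ^ 2 ∂ν := integral_nonneg fun a => by positivity
  rw [hf.eLpNorm_eq_integral_rpow_norm (by norm_num) (by norm_num)]
  simp only [ENNReal.toReal_ofNat, Real.rpow_ofNat]
  rw [ENNReal.toReal_ofReal (by positivity), ← Real.rpow_natCast, ← Real.rpow_mul h0]
  norm_num

theorem norm_expWeight_smul (z : ℂ) (Φ : ℝ → ℝ) (t : ℝ) (y : H) :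
    ‖expWeight z Φ t • y‖ = |Φ t| * (Real.exp (-z.re * t) * ‖y‖) := by
  rw [norm_smul, expWeight, norm_mul, norm_exp_neg_mul, Complex.norm_real, Real.norm_eq_abs]
  ring

/-- With the kernel `e^{-2πitξ}`, frequency `ξ` corresponds to the point `μ + 2πiξ` of the line `Re
z = μ`, where the resolvent bound applies. -/
theorem fourier_indicator_expWeight (S : ℝ → H →L[ℂ] H) (x : H) (μ : ℝ) (Φ : ℝ → ℝ) (ξ : ℝ) :
    FourierTransform.fourier
      ((Ioi (0 : ℝ)).indicator fun t => expWeight (μ : ℂ) Φ t • S t x) ξ =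
    ∫ t in Ioi (0 : ℝ), expWeight (μ + 2 * Real.pi * ξ * Complex.I) Φ t • S t x := by
  rw [Real.fourier_real_eq_integral_exp_smul, ← integral_indicator measurableSet_Ioi]
  congr 1
  funext t
  by_cases ht : t ∈ Ioi (0 : ℝ)
  · rw [indicator_of_mem ht, indicator_of_mem ht, ← mul_smul]
    congr 1
    rw [expWeight, expWeight, ← mul_assoc, ← Complex.exp_add]
    congr 2
    push_cast; ring
  · rw [indicator_of_notMem ht, indicator_of_notMem ht, smul_zero]

theorem integrableOn_sq_mul [CompleteSpace H] {S : ℝ → H →L[ℂ] H} {x : H} {μ : ℝ}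
    (hE : IntegrableOn (fun t => (Real.exp (-μ * t) * ‖S t x‖) ^ 2) (Ioi 0))
    {Φ : ℝ → ℝ} {M : ℝ} (hΦ : Measurable Φ) (hM : ∀ t, |Φ t| ≤ M) :
    IntegrableOn (fun t => Φ t ^ 2 * (Real.exp (-μ * t) * ‖S t x‖) ^ 2) (Ioi 0) := by
  refine hE.bdd_mul (c := M ^ 2) (hΦ.pow_const 2).aestronglyMeasurable (ae_of_all _ fun t => ?_)
  rw [norm_pow, Real.norm_eq_abs]
  have := hM t
  gcongr

theorem memLp_indicator_expWeight [CompleteSpace H] {S : ℝ → H →L[ℂ] H} (hS : IsC0Semigroup S)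
    {x : H} {μ : ℝ}
    (hE : IntegrableOn (fun t => (Real.exp (-μ * t) * ‖S t x‖) ^ 2) (Ioi 0))
    {Φ : ℝ → ℝ} {M : ℝ} (hΦ : Measurable Φ) (hM : ∀ t, |Φ t| ≤ M) :
    MemLp ((Ioi (0 : ℝ)).indicator fun t => expWeight (μ : ℂ) Φ t • S t x) 2 := by
  rw [memLp_indicator_iff_restrict measurableSet_Ioi, memLp_two_iff_integrable_sq_norm]
  · refine (integrableOn_sq_mul hE hΦ hM).congr (ae_of_all _ fun t => ?_)
    simp only
    rw [norm_expWeight_smul, mul_pow _ (_ * _), sq_abs, Complex.ofReal_re]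
  · refine AEStronglyMeasurable.smul ?_ (hS.aestronglyMeasurable x)
    unfold expWeight
    fun_prop

theorem toReal_eLpNorm_indicator_expWeight_sq [CompleteSpace H] {S : ℝ → H →L[ℂ] H}
    (hS : IsC0Semigroup S) {x : H} {μ : ℝ}
    (hE : IntegrableOn (fun t => (Real.exp (-μ * t) * ‖S t x‖) ^ 2) (Ioi 0))
    {Φ : ℝ → ℝ} {M : ℝ} (hΦ : Measurable Φ) (hM : ∀ t, |Φ t| ≤ M) :
    (eLpNorm ((Ioi (0 : ℝ)).indicator fun t => expWeight (μ : ℂ) Φ t • S t x) 2 volume).toReal ^ 2 =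
      ∫ t in Ioi (0 : ℝ), Φ t ^ 2 * (Real.exp (-μ * t) * ‖S t x‖) ^ 2 := by
  rw [toReal_eLpNorm_two_sq (memLp_indicator_expWeight hS hE hΦ hM),
    ← integral_indicator measurableSet_Ioi]
  congr 1
  funext t
  by_cases ht : t ∈ Ioi (0 : ℝ)
  · rw [indicator_of_mem ht, indicator_of_mem ht, norm_expWeight_smul, mul_pow _ (_ * _), sq_abs, Complex.ofReal_re]
  · rw [indicator_of_notMem ht, indicator_of_notMem ht, norm_zero]; norm_num

/-- The basic energy inequality: by Plancherel's theorem, a resolvent bound `N` to the right of the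
line `Re z = μ` controls a cut-off orbit by the source term that the cutoff creates. -/
theorem integral_cutoff_sq_le [CompleteSpace H] {S : ℝ → H →L[ℂ] H} (hS : IsC0Semigroup S) {x : H}
    {μ N : ℝ} (hN : 0 ≤ N)
    (hz : ∀ z : ℂ, z.re = μ → z ∈ resolventSetOf (generator S))
    (hR : ∀ z : ℂ, z.re = μ → ‖resolventOf (generator S) z‖ ≤ N)
    (hint : IntegrableOn (fun t => Real.exp (-μ * t) * ‖S t x‖) (Ioi 0))
    (hE : IntegrableOn (fun t => (Real.exp (-μ * t) * ‖S t x‖) ^ 2) (Ioi 0))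
    {Φ : ℝ → ℝ} {K : NNReal} {M : ℝ} (hK : LipschitzWith K Φ) (hM : ∀ t, |Φ t| ≤ M)
    (h0 : ∀ t ≤ 0, Φ t = 0) :
    ∫ t in Ioi (0 : ℝ), Φ t ^ 2 * (Real.exp (-μ * t) * ‖S t x‖) ^ 2 ≤
      N ^ 2 * ∫ t in Ioi (0 : ℝ), deriv Φ t ^ 2 * (Real.exp (-μ * t) * ‖S t x‖) ^ 2 := by
  have hK' : ∀ t, |deriv Φ t| ≤ K := fun t => norm_deriv_le_of_lipschitz hK
  have hm := hK.continuous.measurable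
  have hm' := measurable_deriv Φ
  have hint' : IntegrableOn (fun t => Real.exp (-(μ : ℂ).re * t) * ‖S t x‖) (Ioi 0) := hint
  have i1 := (integrable_indicator_iff measurableSet_Ioi).2
    (integrableOn_expWeight hS x hint' hm hM)
  have i2 := (integrable_indicator_iff measurableSet_Ioi).2
    (integrableOn_expWeight hS x hint' hm' hK')
  have l1 := memLp_indicator_expWeight hS hE hm hM
  have l2 := memLp_indicator_expWeight hS hE hm' hK'
  have hF : eLpNorm ((Ioi (0 : ℝ)).indicator fun t => expWeight (μ : ℂ) Φ t • S t x) 2 volume ≤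
      ENNReal.ofReal N *
        eLpNorm ((Ioi (0 : ℝ)).indicator fun t => expWeight (μ : ℂ) (deriv Φ) t • S t x) 2 volume := by
    rw [← eLpNorm_fourier_eq i1 l1, ← eLpNorm_fourier_eq i2 l2]
    refine eLpNorm_le_mul_eLpNorm_of_ae_le_mul (ae_of_all _ fun ξ => ?_) 2
    have hre : ((μ : ℂ) + 2 * Real.pi * ξ * Complex.I).re = μ := by simp
    rw [fourier_indicator_expWeight, fourier_indicator_expWeight,
      laplace_cutoff_orbit hS x (hz _ hre) (by rwa [hre]) hK hM h0]
    exact ContinuousLinearMap.le_of_opNorm_le _ (hR _ hre) _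
  have hF' := ENNReal.toReal_mono (ENNReal.mul_ne_top ENNReal.ofReal_ne_top l2.eLpNorm_ne_top) hF
  rw [ENNReal.toReal_mul, ENNReal.toReal_ofReal hN] at hF'
  rw [← toReal_eLpNorm_indicator_expWeight_sq hS hE hm hM,
    ← toReal_eLpNorm_indicator_expWeight_sq hS hE hm' hK', ← mul_pow]
  gcongr

/-! ### The exponential cutoff and its energy inequality. -/

theorem lipschitzWith_comp_clamp {G g : ℝ → ℝ} (hG : ∀ s, HasDerivAt G (g s) s)
    (hg : Continuous g) {a c : ℝ} (hac : a ≤ c) :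
    ∃ K : NNReal, LipschitzWith K (fun s => G (max a (min s c))) := by
  obtain ⟨C, hC⟩ := isCompact_Icc.exists_bound_of_continuousOn (hg.continuousOn (s := Icc a c))
  have h1 : LipschitzOnWith C.toNNReal G (Icc a c) :=
    Convex.lipschitzOnWith_of_nnnorm_hasDerivWithin_le (convex_Icc a c)
      (fun s _ => (hG s).hasDerivWithinAt)
      (fun s hs => by
        rw [← NNReal.coe_le_coe, coe_nnnorm]
        exact (hC s hs).trans (Real.le_coe_toNNReal C))
  have h2 : LipschitzWith 1 (fun s : ℝ => max a (min s c)) :=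
    (LipschitzWith.id.min_const c).const_max a
  refine ⟨C.toNNReal * 1, ?_⟩
  rw [← lipschitzOnWith_univ] at h2 ⊢
  exact h1.comp h2 fun s _ => ⟨le_max_left _ _, max_le hac (min_le_right _ _)⟩

theorem exists_bound_comp_clamp {G : ℝ → ℝ} (hG : Continuous G) {a c : ℝ} (hac : a ≤ c) :
    ∃ M : ℝ, ∀ s, |G (max a (min s c))| ≤ M := by
  obtain ⟨C, hC⟩ := isCompact_Icc.exists_bound_of_continuousOn (hG.continuousOn (s := Icc a c))
  exact ⟨C, fun s => hC _ ⟨le_max_left _ _, max_le hac (min_le_right _ _)⟩⟩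

/-- The cutoff which follows `G` on `[0, a]`, grows like `e^{ρ·}` on `[a, c]`, and is constant on
either side of `[0, c]`. -/
def expCutoff (G : ℝ → ℝ) (ρ a c s : ℝ) : ℝ :=
  -- When `G a = 1`, one of the two summands equals 1 on each side of `a`; subtracting 1 leaves the
  -- other.
  G (max 0 (min s a)) + Real.exp (ρ * (max a (min s c) - a)) - 1

section expCutoff

variable {G g : ℝ → ℝ} {ρ a c s : ℝ}

theorem expCutoff_of_nonpos (h0 : G 0 = 0) (ha : 0 ≤ a) (hac : a ≤ c) (hs : s ≤ 0) :
    expCutoff G ρ a c s = 0 := by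
  rw [expCutoff, min_eq_left (hs.trans ha), max_eq_left hs, min_eq_left (by linarith),
    max_eq_left (hs.trans ha), h0]
  simp

theorem expCutoff_of_le_left (hac : a ≤ c) (h : 0 ≤ s) (hs : s ≤ a) :
    expCutoff G ρ a c s = G s := by
  rw [expCutoff, min_eq_left hs, max_eq_right h, min_eq_left (by linarith), max_eq_left hs]
  simp

theorem expCutoff_of_mem_Icc (h1 : G a = 1) (ha : 0 ≤ a) (hs : s ∈ Icc a c) :
    expCutoff G ρ a c s = Real.exp (ρ * (s - a)) := by
  rw [expCutoff, min_eq_right hs.1, max_eq_right ha, min_eq_left hs.2, max_eq_right hs.1, h1]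
  ring

theorem expCutoff_of_ge (h1 : G a = 1) (ha : 0 ≤ a) (hac : a ≤ c) (hs : c ≤ s) :
    expCutoff G ρ a c s = Real.exp (ρ * (c - a)) := by
  rw [expCutoff, min_eq_right (hac.trans hs), max_eq_right ha, min_eq_right hs,
    max_eq_right hac, h1]
  ring

theorem deriv_expCutoff_left (hG : ∀ s, HasDerivAt G (g s) s) (hac : a ≤ c) (hs : s ∈ Ioo 0 a) :
    deriv (expCutoff G ρ a c) s = g s := by
  refine HasDerivAt.deriv ((hG s).congr_of_eventuallyEq ?_)
  filter_upwards [Ioo_mem_nhds hs.1 hs.2] with y hy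
  exact expCutoff_of_le_left hac hy.1.le hy.2.le

theorem deriv_expCutoff_middle (h1 : G a = 1) (ha : 0 ≤ a) (hs : s ∈ Ioo a c) :
    deriv (expCutoff G ρ a c) s = ρ * Real.exp (ρ * (s - a)) := by
  have : HasDerivAt (fun s => Real.exp (ρ * (s - a))) (Real.exp (ρ * (s - a)) * (ρ * 1)) s :=
    (((hasDerivAt_id s).sub_const a).const_mul ρ).exp
  rw [mul_one, mul_comm] at this
  refine HasDerivAt.deriv (this.congr_of_eventuallyEq ?_)
  filter_upwards [Ioo_mem_nhds hs.1 hs.2] with y hy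
  exact expCutoff_of_mem_Icc h1 ha (Ioo_subset_Icc_self hy)

theorem deriv_expCutoff_right (h1 : G a = 1) (ha : 0 ≤ a) (hac : a ≤ c) (hs : c < s) :
    deriv (expCutoff G ρ a c) s = 0 := by
  refine HasDerivAt.deriv ((hasDerivAt_const s (Real.exp (ρ * (c - a)))).congr_of_eventuallyEq ?_)
  filter_upwards [Ioi_mem_nhds hs] with y hy
  exact expCutoff_of_ge h1 ha hac (le_of_lt hy)

theorem lipschitzWith_expCutoff (hG : ∀ s, HasDerivAt G (g s) s) (hg : Continuous g)
    (ha : 0 ≤ a) (hac : a ≤ c) : ∃ K, LipschitzWith K (expCutoff G ρ a c) := by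
  obtain ⟨K₁, h₁⟩ := lipschitzWith_comp_clamp hG hg ha
  obtain ⟨K₂, h₂⟩ := lipschitzWith_comp_clamp (G := fun s => Real.exp (ρ * (s - a)))
    (fun s => (((hasDerivAt_id s).sub_const a).const_mul ρ).exp) (by fun_prop) hac
  exact ⟨_, (h₁.add h₂).sub (LipschitzWith.const 1)⟩

theorem exists_bound_expCutoff (hG : Continuous G) (ha : 0 ≤ a) (hac : a ≤ c) :
    ∃ M, ∀ s, |expCutoff G ρ a c s| ≤ M := by
  obtain ⟨M₁, h₁⟩ := exists_bound_comp_clamp hG ha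
  obtain ⟨M₂, h₂⟩ := exists_bound_comp_clamp (G := fun s => Real.exp (ρ * (s - a)))
    (by fun_prop) hac
  refine ⟨M₁ + M₂ + 1, fun s => ?_⟩
  rw [expCutoff]
  refine (abs_sub _ _).trans (add_le_add ((abs_add_le _ _).trans (add_le_add (h₁ s) (h₂ s))) ?_)
  simp

end expCutoff

/-- The energy inequality for the cutoff `expCutoff G ρ a c`. -/
theorem expCutoff_energy_le [CompleteSpace H] {S : ℝ → H →L[ℂ] H} (hS : IsC0Semigroup S) {x : H}
    {μ N : ℝ} (hN : 0 ≤ N)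
    (hz : ∀ z : ℂ, z.re = μ → z ∈ resolventSetOf (generator S))
    (hR : ∀ z : ℂ, z.re = μ → ‖resolventOf (generator S) z‖ ≤ N)
    (hint : IntegrableOn (fun t => Real.exp (-μ * t) * ‖S t x‖) (Ioi 0))
    (hE : IntegrableOn (fun t => (Real.exp (-μ * t) * ‖S t x‖) ^ 2) (Ioi 0))
    {G g : ℝ → ℝ} (hG : ∀ s, HasDerivAt G (g s) s) (hg : Continuous g) {ρ a c t : ℝ}
    (h0 : G 0 = 0) (h1 : G a = 1) (ha : 0 ≤ a) (hac : a ≤ c) :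
    (1 - N ^ 2 * ρ ^ 2) * (∫ s in Ioo a c,
        Real.exp (ρ * (s - a)) ^ 2 * (Real.exp (-μ * s) * ‖S s x‖) ^ 2) +
      Real.exp (ρ * (c - a)) ^ 2 * (∫ s in Ioo c t, (Real.exp (-μ * s) * ‖S s x‖) ^ 2) ≤
    N ^ 2 * ∫ s in Ioo 0 a, g s ^ 2 * (Real.exp (-μ * s) * ‖S s x‖) ^ 2 := by
  obtain ⟨K, hK⟩ := lipschitzWith_expCutoff (ρ := ρ) hG hg ha hac
  have hGc : Continuous G := continuous_iff_continuousAt.2 fun s => (hG s).continuousAt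
  obtain ⟨M, hM⟩ := exists_bound_expCutoff (ρ := ρ) hGc ha hac
  have hK' : ∀ s, |deriv (expCutoff G ρ a c) s| ≤ K := fun s => norm_deriv_le_of_lipschitz hK
  have key := integral_cutoff_sq_le hS hN hz hR hint hE hK hM
    fun s => expCutoff_of_nonpos h0 ha hac
  have i1 := integrableOn_sq_mul hE hK.continuous.measurable hM
  have i2 := integrableOn_sq_mul hE (measurable_deriv _) hK'
  set w : ℝ → ℝ := fun s => (Real.exp (-μ * s) * ‖S s x‖) ^ 2 with hw
  have hw0 : ∀ s, 0 ≤ w s := fun s => by positivity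
  have sub1 : Ioo a c ⊆ Ioi (0 : ℝ) := fun s hs => ha.trans_lt hs.1
  have sub2 : Ioo c t ⊆ Ioi (0 : ℝ) := fun s hs => (ha.trans hac).trans_lt hs.1
  have e1 : (∫ s in Ioo a c, expCutoff G ρ a c s ^ 2 * w s) =
      ∫ s in Ioo a c, Real.exp (ρ * (s - a)) ^ 2 * w s :=
    setIntegral_congr_fun measurableSet_Ioo fun s hs => by
      simp only [expCutoff_of_mem_Icc h1 ha (Ioo_subset_Icc_self hs)]
  have e2 : (∫ s in Ioo c t, expCutoff G ρ a c s ^ 2 * w s) =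
      Real.exp (ρ * (c - a)) ^ 2 * ∫ s in Ioo c t, w s := by
    rw [← integral_const_mul]
    exact setIntegral_congr_fun measurableSet_Ioo fun s hs => by
      simp only [expCutoff_of_ge h1 ha hac hs.1.le]
  -- On the left the energy on `(0, a)` and beyond `t` is simply discarded.
  have l1 : (∫ s in Ioo a c, expCutoff G ρ a c s ^ 2 * w s) +
      (∫ s in Ioo c t, expCutoff G ρ a c s ^ 2 * w s) ≤
      ∫ s in Ioi (0 : ℝ), expCutoff G ρ a c s ^ 2 * w s := by
    rw [← setIntegral_union _ measurableSet_Ioo (i1.mono_set sub1) (i1.mono_set sub2)]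
    · exact setIntegral_mono_set i1 (ae_of_all _ fun s => mul_nonneg (sq_nonneg _) (hw0 s))
        (union_subset sub1 sub2).eventuallyLE
    · exact Set.disjoint_left.2 fun s hs hs' => absurd hs.2 (not_lt.2 hs'.1.le)
  have f1 : (∫ s in Ioo 0 a, deriv (expCutoff G ρ a c) s ^ 2 * w s) =
      ∫ s in Ioo 0 a, g s ^ 2 * w s :=
    setIntegral_congr_fun measurableSet_Ioo fun s hs => by
      simp only [deriv_expCutoff_left hG hac hs]
  have f2 : (∫ s in Ioo a c, deriv (expCutoff G ρ a c) s ^ 2 * w s) =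
      ρ ^ 2 * ∫ s in Ioo a c, Real.exp (ρ * (s - a)) ^ 2 * w s := by
    rw [← integral_const_mul]
    exact setIntegral_congr_fun measurableSet_Ioo fun s hs => by
      simp only [deriv_expCutoff_middle h1 ha hs]; ring
  have f3 : (∫ s in Ioi c, deriv (expCutoff G ρ a c) s ^ 2 * w s) = 0 := by
    rw [setIntegral_congr_fun (g := fun _ => (0 : ℝ)) measurableSet_Ioi fun s hs => by
      simp only [deriv_expCutoff_right h1 ha hac hs]; ring]
    simp
  -- The source is computed exactly; the kinks at `a` and `c` form a null set.
  have l2 : (∫ s in Ioi (0 : ℝ), deriv (expCutoff G ρ a c) s ^ 2 * w s) =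
      (∫ s in Ioo 0 a, g s ^ 2 * w s) +
        ρ ^ 2 * ∫ s in Ioo a c, Real.exp (ρ * (s - a)) ^ 2 * w s := by
    rw [← f1, ← f2, ← integral_Ioc_eq_integral_Ioo, ← integral_Ioc_eq_integral_Ioo,
      ← Ioc_union_Ioi_eq_Ioi ha, setIntegral_union Ioc_disjoint_Ioi_same measurableSet_Ioi,
      ← Ioc_union_Ioi_eq_Ioi hac, setIntegral_union Ioc_disjoint_Ioi_same measurableSet_Ioi, f3,
      add_zero]
    · exact i2.mono_set fun s hs => ha.trans_lt hs.1
    · exact i2.mono_set fun s hs => (ha.trans hac).trans_lt hs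
    · exact i2.mono_set fun s hs => hs.1
    · exact i2.mono_set fun s hs => ha.trans_lt hs
  rw [l2] at key
  rw [e1, e2] at l1
  linarith

/-! ### Square integrability of orbits down to the exponent `ω`. -/

theorem IsC0Semigroup.norm_le_exp {S : ℝ → H →L[ℂ] H} (hS : IsC0Semigroup S) {C : ℝ} (hC1 : 1 ≤ C)
    (hC : ∀ t ∈ Icc (0 : ℝ) 1, ‖S t‖ ≤ C) {t : ℝ} (ht : 0 ≤ t) :
    ‖S t‖ ≤ C * Real.exp (Real.log C * t) := by
  have hC0 : 0 < C := by linarith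
  have key : ∀ n : ℕ, ∀ t : ℝ, 0 ≤ t → t ≤ n + 1 → ‖S t‖ ≤ C * Real.exp (Real.log C * t) := by
    intro n
    induction n with
    | zero =>
      intro t h0 h1
      refine (hC t ⟨h0, by simpa using h1⟩).trans (le_mul_of_one_le_right hC0.le ?_)
      exact Real.one_le_exp (mul_nonneg (Real.log_nonneg hC1) h0)
    | succ n ih =>
      intro t h0 h1
      rcases le_total t (n + 1) with h | h
      · exact ih t h0 h
      have hn : (0 : ℝ) ≤ n := n.cast_nonneg
      have e : S t = (S 1).comp (S (t - 1)) := by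
        rw [← hS.map_add 1 (t - 1) zero_le_one (by linarith)]; congr 1; ring
      push_cast at h1
      calc ‖S t‖ ≤ ‖S 1‖ * ‖S (t - 1)‖ := e ▸ ContinuousLinearMap.opNorm_comp_le _ _
        _ ≤ C * (C * Real.exp (Real.log C * (t - 1))) := by
          gcongr
          · exact hC 1 (by simp)
          · exact ih _ (by linarith) (by linarith)
        _ = C * Real.exp (Real.log C * t) := by
          rw [mul_sub, mul_one, Real.exp_sub, Real.exp_log hC0]
          field_simp
  obtain ⟨n, hn⟩ := exists_nat_ge t
  exact key n t ht (by linarith)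

theorem exists_integrableOn_sq {S : ℝ → H →L[ℂ] H} (hS : IsC0Semigroup S) {C : ℝ}
    (hC : ∀ t ∈ Icc (0 : ℝ) 1, ‖S t‖ ≤ C) (x : H) :
    ∃ μ : ℝ, IntegrableOn (fun t => (Real.exp (-μ * t) * ‖S t x‖) ^ 2) (Ioi 0) := by
  have hC' : ∀ t ∈ Icc (0 : ℝ) 1, ‖S t‖ ≤ max C 1 := fun t ht => (hC t ht).trans (le_max_left _ _)
  set D := max C 1
  have hD : 1 ≤ D := le_max_right _ _
  refine ⟨Real.log D + 1, ?_⟩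
  refine ((integrableOn_exp_mul_Ioi (a := -2) (by norm_num) 0).const_mul ((D * ‖x‖) ^ 2)).mono' ?_ ?_
  · exact ((by fun_prop : AEStronglyMeasurable (fun t : ℝ => Real.exp (-(Real.log D + 1) * t)) _).mul
      (hS.aestronglyMeasurable x).norm).pow 2
  · refine (ae_restrict_iff' measurableSet_Ioi).2 (ae_of_all _ fun t ht => ?_)
    have h : ‖S t x‖ ≤ D * Real.exp (Real.log D * t) * ‖x‖ :=
      (S t).le_of_opNorm_le (hS.norm_le_exp hD hC' (le_of_lt ht)) x
    rw [Real.norm_of_nonneg (by positivity)]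
    calc (Real.exp (-(Real.log D + 1) * t) * ‖S t x‖) ^ 2
        ≤ (Real.exp (-(Real.log D + 1) * t) * (D * Real.exp (Real.log D * t) * ‖x‖)) ^ 2 := by gcongr
      _ = (D * ‖x‖) ^ 2 * (Real.exp (-(Real.log D + 1) * t) * Real.exp (Real.log D * t)) ^ 2 := by ring
      _ = (D * ‖x‖) ^ 2 * Real.exp (-2 * t) := by
        rw [← Real.exp_add, ← Real.exp_nat_mul]
        congr 2; push_cast; ring

theorem integrableOn_sq_of_le {S : ℝ → H →L[ℂ] H} (hS : IsC0Semigroup S) {x : H} {μ₀ μ : ℝ}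
    (hE : IntegrableOn (fun t => (Real.exp (-μ₀ * t) * ‖S t x‖) ^ 2) (Ioi 0)) (h : μ₀ ≤ μ) :
    IntegrableOn (fun t => (Real.exp (-μ * t) * ‖S t x‖) ^ 2) (Ioi 0) := by
  refine hE.mono' ?_ ?_
  · exact ((by fun_prop : AEStronglyMeasurable (fun t : ℝ => Real.exp (-μ * t)) _).mul
      (hS.aestronglyMeasurable x).norm).pow 2
  · refine (ae_restrict_iff' measurableSet_Ioi).2 (ae_of_all _ fun t ht => ?_)
    have : 0 < t := ht
    rw [Real.norm_of_nonneg (by positivity)]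
    gcongr

/-- The integrand is `e^{(μ₀-μ)t}` times a square integrable function, and `pq ≤ p² + q²`. The
strict inequality makes the first factor square integrable. -/
theorem integrableOn_of_lt {S : ℝ → H →L[ℂ] H} (hS : IsC0Semigroup S) {x : H} {μ₀ μ : ℝ}
    (hE : IntegrableOn (fun t => (Real.exp (-μ₀ * t) * ‖S t x‖) ^ 2) (Ioi 0)) (h : μ₀ < μ) :
    IntegrableOn (fun t => Real.exp (-μ * t) * ‖S t x‖) (Ioi 0) := by
  refine ((integrableOn_exp_mul_Ioi (a := 2 * (μ₀ - μ)) (by linarith) 0).add hE).mono' ?_ ?_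
  · exact (by fun_prop : AEStronglyMeasurable (fun t : ℝ => Real.exp (-μ * t)) _).mul
      (hS.aestronglyMeasurable x).norm
  · refine ae_of_all _ fun t => ?_
    rw [Real.norm_of_nonneg (by positivity)]
    have e1 : Real.exp (-μ * t) = Real.exp ((μ₀ - μ) * t) * Real.exp (-μ₀ * t) := by
      rw [← Real.exp_add]; congr 1; ring
    have e2 : Real.exp (2 * (μ₀ - μ) * t) = Real.exp ((μ₀ - μ) * t) ^ 2 := by
      rw [← Real.exp_nat_mul]; congr 1; push_cast; ring
    simp only [Pi.add_apply]
    rw [e1, e2]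
    have : 0 ≤ Real.exp ((μ₀ - μ) * t) * (Real.exp (-μ₀ * t) * ‖S t x‖) := by positivity
    nlinarith [sq_nonneg (Real.exp ((μ₀ - μ) * t) - Real.exp (-μ₀ * t) * ‖S t x‖)]

/-- The energy inequality is applied at `μ₀ + 1/(4N)`, where the orbit is also weighted-`L¹`, with
growth rate `ρ = 1/(2N)`. The rate lowers the exponent by twice the margin just added, a net gain of
`1/(4N)`, and `ρ < 1/N` leaves the positive factor `1 - N²ρ² = 3/4`. -/
theorem integrableOn_sq_descend [CompleteSpace H] {S : ℝ → H →L[ℂ] H} (hS : IsC0Semigroup S) {x : H}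
    {ω N μ₀ : ℝ} (hN : 0 < N)
    (hz : ∀ z : ℂ, ω < z.re → z ∈ resolventSetOf (generator S))
    (hR : ∀ z : ℂ, ω < z.re → ‖resolventOf (generator S) z‖ ≤ N) (hμ : ω ≤ μ₀)
    (hE : IntegrableOn (fun t => (Real.exp (-μ₀ * t) * ‖S t x‖) ^ 2) (Ioi 0)) :
    IntegrableOn (fun t => (Real.exp (-(μ₀ - 1 / (4 * N)) * t) * ‖S t x‖) ^ 2) (Ioi 0) := by
  have hN4 : 0 < 1 / (4 * N) := by positivity
  set μ := μ₀ + 1 / (4 * N) with hμdef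
  set ρ := 1 / (2 * N) with hρ
  set ν := μ₀ - 1 / (4 * N) with hν
  have hνρ : ν = μ - ρ := by rw [hμdef, hρ, hν]; field_simp; ring
  have hlt : μ₀ < μ := by linarith
  have hcont : ContinuousOn (fun t => (Real.exp (-ν * t) * ‖S t x‖) ^ 2) (Ici 0) :=
    (ContinuousOn.mul (by fun_prop) (hS.strongly_continuous x).norm).pow 2
  have hloc : ∀ a b : ℝ, 0 ≤ a →
      IntegrableOn (fun t => (Real.exp (-ν * t) * ‖S t x‖) ^ 2) (Ioc a b) := fun a b ha =>
    ((hcont.mono fun t ht => ha.trans ht.1).integrableOn_compact isCompact_Icc).mono_set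
      Ioc_subset_Icc_self
  rw [← Ioc_union_Ioi_eq_Ioi (zero_le_one' ℝ)]
  refine (hloc 0 1 le_rfl).union ?_
  set B := N ^ 2 * ∫ s in Ioo (0 : ℝ) 1, (1 : ℝ) ^ 2 * (Real.exp (-μ * s) * ‖S s x‖) ^ 2 with hB
  refine integrableOn_Ioi_of_intervalIntegral_norm_bounded (Real.exp ρ ^ 2 * (4 / 3 * B)) 1
    (fun T : ℝ => hloc 1 T zero_le_one) tendsto_id ?_
  filter_upwards [eventually_ge_atTop (1 : ℝ)] with T hT
  -- The ramp is linear on `[0, 1]`. Taking `c = t = T` removes the tail term, and the resulting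
  -- bound is uniform in `T`.
  have key := expCutoff_energy_le hS hN.le (fun z h => hz z (by linarith))
    (fun z h => hR z (by linarith)) (integrableOn_of_lt hS hE hlt)
    (integrableOn_sq_of_le hS hE hlt.le) (G := fun s => s) (g := fun _ => 1) (ρ := ρ) (t := T)
    hasDerivAt_id continuous_const rfl rfl zero_le_one hT
  rw [Ioo_self, setIntegral_empty, mul_zero, add_zero, ← hB,
    show 1 - N ^ 2 * ρ ^ 2 = 3 / 4 by rw [hρ]; field_simp; norm_num] at key
  have e : (∫ s in (1 : ℝ)..T, ‖(Real.exp (-ν * s) * ‖S s x‖) ^ 2‖) =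
      Real.exp ρ ^ 2 * ∫ s in Ioo (1 : ℝ) T,
        Real.exp (ρ * (s - 1)) ^ 2 * (Real.exp (-μ * s) * ‖S s x‖) ^ 2 := by
    rw [intervalIntegral.integral_of_le hT, integral_Ioc_eq_integral_Ioo, ← integral_const_mul]
    congr 1
    funext s
    rw [Real.norm_of_nonneg (by positivity), ← mul_pow, ← mul_pow, ← mul_assoc, ← mul_assoc,
      ← Real.exp_add, ← Real.exp_add, hνρ]
    congr 3; ring
  rw [e]
  gcongr
  linarith

theorem integrableOn_sq_abscissa [CompleteSpace H] {S : ℝ → H →L[ℂ] H} (hS : IsC0Semigroup S) {x : H}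
    {ω N C : ℝ} (hN : 0 < N) (hC : ∀ t ∈ Icc (0 : ℝ) 1, ‖S t‖ ≤ C)
    (hz : ∀ z : ℂ, ω < z.re → z ∈ resolventSetOf (generator S))
    (hR : ∀ z : ℂ, ω < z.re → ‖resolventOf (generator S) z‖ ≤ N) :
    IntegrableOn (fun t => (Real.exp (-ω * t) * ‖S t x‖) ^ 2) (Ioi 0) := by
  obtain ⟨μ, hμ⟩ := exists_integrableOn_sq hS hC x
  -- Truncating at `ω` keeps every starting exponent in the range where `integrableOn_sq_descend` is
  -- available; finitely many steps reach `ω`.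
  have key : ∀ n : ℕ, IntegrableOn
      (fun t => (Real.exp (-(max ω (μ - n * (1 / (4 * N)))) * t) * ‖S t x‖) ^ 2) (Ioi 0) := by
    intro n
    induction n with
    | zero => exact integrableOn_sq_of_le hS hμ (by simp)
    | succ n ih =>
      refine integrableOn_sq_of_le hS (integrableOn_sq_descend hS hN hz hR (le_max_left _ _) ih) ?_
      have : 0 < 1 / (4 * N) := by positivity
      rw [sub_le_iff_le_add]
      push_cast
      refine max_le ?_ ?_
      · linarith [le_max_left ω (μ - (n + 1) * (1 / (4 * N)))]
      · linarith [le_max_right ω (μ - (n + 1) * (1 / (4 * N)))]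
  obtain ⟨n, hn⟩ := exists_nat_ge ((μ - ω) / (1 / (4 * N)))
  have := key n
  rwa [max_eq_left] at this
  rw [div_le_iff₀ (by positivity)] at hn
  linarith

/-! ### The weight attached to `m`. -/

/-- The density `e^{2ω·} / m²`, extended continuously to the whole line. -/
def weightDensity (ω : ℝ) (m : ℝ → ℝ) (s : ℝ) : ℝ := (Real.exp (ω * s) * (1 / m (max s 0))) ^ 2

section weightDensity

variable {ω : ℝ} {m : ℝ → ℝ}

theorem continuous_weight (hm_cont : ContinuousOn m (Ici 0)) (hm_pos : ∀ t : ℝ, 0 ≤ t → 0 < m t) :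
    Continuous fun s => Real.exp (ω * s) * (1 / m (max s 0)) := by
  have h1 : Continuous fun s : ℝ => m (max s 0) :=
    hm_cont.comp_continuous (by fun_prop) fun s => le_max_right s 0
  exact (by fun_prop : Continuous fun s => Real.exp (ω * s)).mul
    (continuous_const.div h1 fun s => (hm_pos _ (le_max_right s 0)).ne')

theorem continuous_weightDensity (hm_cont : ContinuousOn m (Ici 0))
    (hm_pos : ∀ t : ℝ, 0 ≤ t → 0 < m t) : Continuous (weightDensity ω m) :=
  (continuous_weight hm_cont hm_pos).pow 2

theorem weightDensity_pos (hm_pos : ∀ t : ℝ, 0 ≤ t → 0 < m t) (s : ℝ) :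
    0 < weightDensity ω m s := by
  have := hm_pos _ (le_max_right s 0)
  unfold weightDensity
  positivity

theorem weightedL2Norm_sq (hm_cont : ContinuousOn m (Ici 0)) (hm_pos : ∀ t : ℝ, 0 ≤ t → 0 < m t)
    {a : ℝ} (ha : 0 ≤ a) :
    weightedL2Norm ω a (fun s => 1 / m s) ^ 2 = ∫ s in (0 : ℝ)..a, weightDensity ω m s := by
  have e : weightedL2Norm ω a (fun s => 1 / m s) =
      (eLpNorm (fun s => Real.exp (ω * s) * (1 / m (max s 0))) 2
        (volume.restrict (Ioo 0 a))).toReal := by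
    rw [weightedL2Norm]
    congr 1
    refine eLpNorm_congr_ae ((ae_restrict_iff' measurableSet_Ioo).2 (ae_of_all _ fun s hs => ?_))
    simp only [max_eq_left hs.1.le]
  have hc := continuous_weight (ω := ω) hm_cont hm_pos
  have hL : MemLp (fun s => Real.exp (ω * s) * (1 / m (max s 0))) 2
      (volume.restrict (Ioo 0 a)) := by
    rw [memLp_two_iff_integrable_sq hc.aestronglyMeasurable]
    exact ((hc.pow 2).continuousOn.integrableOn_compact isCompact_Icc).mono_set Ioo_subset_Icc_self
  rw [e, toReal_eLpNorm_two_sq hL, intervalIntegral.integral_of_le ha,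
    integral_Ioc_eq_integral_Ioo]
  simp only [Real.norm_eq_abs, sq_abs, weightDensity]

theorem weightedL2Norm_pos (hm_cont : ContinuousOn m (Ici 0)) (hm_pos : ∀ t : ℝ, 0 ≤ t → 0 < m t)
    {a : ℝ} (ha : 0 < a) : 0 < weightedL2Norm ω a (fun s => 1 / m s) := by
  have h : 0 < weightedL2Norm ω a (fun s => 1 / m s) ^ 2 := by
    rw [weightedL2Norm_sq hm_cont hm_pos ha.le]
    exact intervalIntegral.intervalIntegral_pos_of_pos
      ((continuous_weightDensity hm_cont hm_pos).intervalIntegrable _ _)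
      (weightDensity_pos hm_pos) ha
  exact lt_of_le_of_ne ENNReal.toReal_nonneg fun h0 => by
    rw [← h0] at h; simp at h

end weightDensity

/-! ### The semigroup bound from a resolvent bound `N`. -/

theorem orbit_le_of_lt [CompleteSpace H] {S : ℝ → H →L[ℂ] H} (hS : IsC0Semigroup S)
    {ω N : ℝ} (hN : 0 < N)
    (hz : ∀ z : ℂ, ω < z.re → z ∈ resolventSetOf (generator S))
    (hR : ∀ z : ℂ, ω < z.re → ‖resolventOf (generator S) z‖ ≤ N)
    {m : ℝ → ℝ} (hm_cont : ContinuousOn m (Ici 0)) (hm_pos : ∀ t : ℝ, 0 ≤ t → 0 < m t)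
    (hm : ∀ t : ℝ, 0 ≤ t → ‖S t‖ ≤ m t) {a b t : ℝ} (ha : 0 < a) (hb : 0 < b) (hab : a + b ≤ t)
    (x : H) {μ : ℝ} (hμ : ω < μ) :
    Real.exp (N⁻¹ * (t - a - b)) * (Real.exp (-μ * t) * ‖S t x‖) *
        weightedL2Norm ω b (fun s => 1 / m s) ≤
      N * (‖x‖ / weightedL2Norm ω a (fun s => 1 / m s)) := by
  obtain ⟨C, hC⟩ := isCompact_Icc.exists_bound_of_continuousOn
    (hm_cont.mono (fun s hs => hs.1 : Icc (0 : ℝ) 1 ⊆ Ici 0))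
  have hE := integrableOn_sq_abscissa hS (x := x) hN
    (fun s hs => (hm s hs.1).trans ((le_abs_self _).trans (hC s hs))) hz hR
  have hEμ := integrableOn_sq_of_le hS hE hμ.le
  set p := weightDensity ω m with hp
  have hpc : Continuous p := continuous_weightDensity hm_cont hm_pos
  have hp0 : ∀ s, 0 < p s := weightDensity_pos hm_pos
  set Wa := weightedL2Norm ω a (fun s => 1 / m s)
  set Wb := weightedL2Norm ω b (fun s => 1 / m s)
  have hWa : 0 < Wa := weightedL2Norm_pos hm_cont hm_pos ha
  have hWb : 0 < Wb := weightedL2Norm_pos hm_cont hm_pos hb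
  have hWa2 : Wa ^ 2 = ∫ s in (0 : ℝ)..a, p s := weightedL2Norm_sq hm_cont hm_pos ha.le
  have hWb2 : Wb ^ 2 = ∫ s in (0 : ℝ)..b, p s := weightedL2Norm_sq hm_cont hm_pos hb.le
  -- The ramp is the normalized primitive of `p`. By Cauchy–Schwarz it minimizes `∫ g²/p` among
  -- ramps from 0 to 1, and `p w ≤ ‖x‖²` reduces the source to that integral. The rate `ρ = 1/N`
  -- makes the middle term vanish.
  have key := expCutoff_energy_le hS hN.le (fun z h => hz z (by linarith))
    (fun z h => hR z (by linarith)) (integrableOn_of_lt hS hE hμ) hEμ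
    (G := fun s => (∫ τ in (0 : ℝ)..s, p τ) / Wa ^ 2) (g := fun s => p s / Wa ^ 2)
    (ρ := N⁻¹) (a := a) (c := t - b) (t := t)
    (fun s => (hpc.integral_hasStrictDerivAt 0 s).hasDerivAt.div_const _) (by fun_prop)
    (by simp) (by rw [← hWa2]; field_simp) ha.le (by linarith)
  rw [show 1 - N ^ 2 * N⁻¹ ^ 2 = 0 by field_simp; norm_num, zero_mul, zero_add,
    show t - b - a = t - a - b by ring] at key
  have hright : ∫ s in Ioo 0 a, (p s / Wa ^ 2) ^ 2 * (Real.exp (-μ * s) * ‖S s x‖) ^ 2 ≤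
      (‖x‖ / Wa) ^ 2 := by
    have e : (‖x‖ / Wa) ^ 2 = ∫ s in Ioo 0 a, ‖x‖ ^ 2 / Wa ^ 4 * p s := by
      rw [integral_const_mul, ← integral_Ioc_eq_integral_Ioo,
        ← intervalIntegral.integral_of_le ha.le, ← hWa2]
      field_simp
    rw [e]
    refine integral_mono_of_nonneg (ae_of_all _ fun s => by positivity) ?_
      ((ae_restrict_iff' measurableSet_Ioo).2 (ae_of_all _ fun s hs => ?_))
    · exact ((hpc.continuousOn.integrableOn_compact isCompact_Icc).mono_set
        Ioo_subset_Icc_self).const_mul _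
    · have hs0 := hs.1
      have hms := hm_pos s hs0.le
      have h1 : ‖S s x‖ ≤ m s * ‖x‖ := (S s).le_of_opNorm_le (hm s hs0.le) x
      have h2 : p s * (Real.exp (-μ * s) * ‖S s x‖) ^ 2 ≤ ‖x‖ ^ 2 := by
        rw [hp, weightDensity, max_eq_left hs0.le, ← mul_pow]
        refine pow_le_pow_left₀ (by positivity) ?_ 2
        calc Real.exp (ω * s) * (1 / m s) * (Real.exp (-μ * s) * ‖S s x‖)
            = Real.exp (ω * s + -μ * s) * (‖S s x‖ / m s) := by rw [Real.exp_add]; ring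
          _ ≤ 1 * ‖x‖ := by
            gcongr
            · exact Real.exp_le_one_iff.2 (by nlinarith)
            · rw [div_le_iff₀ hms]; linarith
          _ = ‖x‖ := one_mul _
      calc (p s / Wa ^ 2) ^ 2 * (Real.exp (-μ * s) * ‖S s x‖) ^ 2
          = p s / Wa ^ 4 * (p s * (Real.exp (-μ * s) * ‖S s x‖) ^ 2) := by ring
        _ ≤ p s / Wa ^ 4 * ‖x‖ ^ 2 := by
          have := (hp0 s).le
          gcongr
        _ = _ := by ring
  -- Each `s` in the last window controls the endpoint through `S t = S (t - s) S s`, so the weight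
  -- appears reflected, as `p (t - s)`.
  have hleft : (Real.exp (-μ * t) * ‖S t x‖) ^ 2 * Wb ^ 2 ≤
      ∫ s in Ioo (t - b) t, (Real.exp (-μ * s) * ‖S s x‖) ^ 2 := by
    have e : Wb ^ 2 = ∫ s in Ioo (t - b) t, p (t - s) := by
      rw [hWb2, ← integral_Ioc_eq_integral_Ioo, ← intervalIntegral.integral_of_le (by linarith),
        intervalIntegral.integral_comp_sub_left (fun s => p s) t]
      simp
    rw [e, ← integral_const_mul]
    refine integral_mono_of_nonneg
      (ae_of_all _ fun s => mul_nonneg (sq_nonneg _) (hp0 _).le) ?_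
      ((ae_restrict_iff' measurableSet_Ioo).2 (ae_of_all _ fun s hs => ?_))
    · exact hEμ.mono_set fun s hs => (by linarith : (0 : ℝ) ≤ t - b).trans_lt hs.1
    · have hs0 : 0 ≤ t - s := by linarith [hs.2]
      have hs1 : 0 ≤ s := by linarith [hs.1]
      have hms := hm_pos _ hs0
      have h1 : ‖S t x‖ ≤ m (t - s) * ‖S s x‖ := by
        have : S t = (S (t - s)).comp (S s) := by
          rw [← hS.map_add _ _ hs0 hs1]; congr 1; ring
        rw [this]
        exact (S (t - s)).le_of_opNorm_le (hm _ hs0) _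
      simp only
      rw [hp, weightDensity, max_eq_left hs0, ← mul_pow]
      refine pow_le_pow_left₀ (by positivity) ?_ 2
      calc Real.exp (-μ * t) * ‖S t x‖ * (Real.exp (ω * (t - s)) * (1 / m (t - s)))
          = Real.exp (-μ * t + ω * (t - s)) * (‖S t x‖ / m (t - s)) := by rw [Real.exp_add]; ring
        _ ≤ Real.exp (-μ * s) * ‖S s x‖ := by
          gcongr
          · nlinarith
          · rw [div_le_iff₀ hms]; linarith
  have hWb' := hWb.le
  rw [← pow_le_pow_iff_left₀ (by positivity) (by positivity) two_ne_zero]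
  calc (Real.exp (N⁻¹ * (t - a - b)) * (Real.exp (-μ * t) * ‖S t x‖) * Wb) ^ 2
      = Real.exp (N⁻¹ * (t - a - b)) ^ 2 * ((Real.exp (-μ * t) * ‖S t x‖) ^ 2 * Wb ^ 2) := by ring
    _ ≤ Real.exp (N⁻¹ * (t - a - b)) ^ 2 *
        ∫ s in Ioo (t - b) t, (Real.exp (-μ * s) * ‖S s x‖) ^ 2 := by gcongr
    _ ≤ _ := key
    _ ≤ N ^ 2 * (‖x‖ / Wa) ^ 2 := by gcongr
    _ = _ := by ring

/-- The semigroup bound in terms of an arbitrary positive bound `N` on the resolvent. -/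
theorem norm_le_of_resolvent_bound [CompleteSpace H] {S : ℝ → H →L[ℂ] H} (hS : IsC0Semigroup S)
    {ω N : ℝ} (hN : 0 < N)
    (hz : ∀ z : ℂ, ω < z.re → z ∈ resolventSetOf (generator S))
    (hR : ∀ z : ℂ, ω < z.re → ‖resolventOf (generator S) z‖ ≤ N)
    {m : ℝ → ℝ} (hm_cont : ContinuousOn m (Ici 0)) (hm_pos : ∀ t : ℝ, 0 ≤ t → 0 < m t)
    (hm : ∀ t : ℝ, 0 ≤ t → ‖S t‖ ≤ m t) {a b t : ℝ} (ha : 0 < a) (hb : 0 < b) (hab : a + b ≤ t) :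
    ‖S t‖ ≤ Real.exp (ω * t - N⁻¹ * (t - a - b)) /
      (N⁻¹ * weightedL2Norm ω a (fun s => 1 / m s) * weightedL2Norm ω b (fun s => 1 / m s)) := by
  have hWa : 0 < weightedL2Norm ω a (fun s => 1 / m s) := weightedL2Norm_pos hm_cont hm_pos ha
  have hWb : 0 < weightedL2Norm ω b (fun s => 1 / m s) := weightedL2Norm_pos hm_cont hm_pos hb
  refine ContinuousLinearMap.opNorm_le_bound _ (by positivity) fun x => ?_
  -- In the bound for `μ > ω` only an exponential depends on `μ`, so the limit `μ ↓ ω` is immediate.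
  have hlim : Real.exp (N⁻¹ * (t - a - b)) * (Real.exp (-ω * t) * ‖S t x‖) *
        weightedL2Norm ω b (fun s => 1 / m s) ≤
      N * (‖x‖ / weightedL2Norm ω a (fun s => 1 / m s)) := by
    have hcont : Continuous fun μ : ℝ => Real.exp (N⁻¹ * (t - a - b)) *
        (Real.exp (-μ * t) * ‖S t x‖) * weightedL2Norm ω b (fun s => 1 / m s) := by fun_prop
    refine le_of_tendsto ((hcont.tendsto ω).mono_left (nhdsWithin_le_nhds (s := Ioi ω))) ?_
    filter_upwards [self_mem_nhdsWithin] with μ hμ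
    exact orbit_le_of_lt hS hN hz hR hm_cont hm_pos hm ha hb hab x hμ
  rw [Real.exp_sub, div_div, div_mul_eq_mul_div, le_div_iff₀ (by positivity)]
  rw [neg_mul, Real.exp_neg] at hlim
  have := Real.exp_pos (ω * t)
  field_simp at hlim ⊢
  linarith

/-! ### The number `r(ω)` and its positivity. -/

theorem norm_resolventOf_le_sSup {A : H →ₗ.[ℂ] H} {ω : ℝ} (h : ResolventBoundedOn A ω) {z : ℂ}
    (hz : ω < z.re) :
    ‖resolventOf A z‖ ≤ sSup ((fun z : ℂ => ‖resolventOf A z‖) '' {z : ℂ | ω < z.re}) := by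
  obtain ⟨C, hC⟩ := h.2
  refine le_csSup ⟨C, ?_⟩ ⟨z, hz, rfl⟩
  rintro _ ⟨w, hw, rfl⟩
  exact hC w (le_of_lt hw)

theorem rOf_nonneg (A : H →ₗ.[ℂ] H) (ω : ℝ) : 0 ≤ rOf A ω := by
  refine inv_nonneg.2 (Real.sSup_nonneg ?_)
  rintro _ ⟨w, -, rfl⟩
  exact norm_nonneg _

/-- A zero inverse turns `(z - A) R y = y` into `0 = y`. Hence on a nontrivial space the supremum
defining `r(ω)` is not zero. -/
theorem IsResolventAt.subsingleton {A : H →ₗ.[ℂ] H} {z : ℂ} (h : IsResolventAt A z 0) :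
    Subsingleton H := by
  refine subsingleton_of_forall_eq 0 fun y => ?_
  obtain ⟨hy, e⟩ := h.1 y
  have : A ⟨(0 : H →L[ℂ] H) y, hy⟩ = 0 := by
    rw [← map_zero A.toFun]; rfl
  rw [this] at e
  simpa using e.symm

/-- On a nontrivial space the number `r(ω)` is positive. -/
theorem rOf_pos [Nontrivial H] {A : H →ₗ.[ℂ] H} {ω : ℝ} (h : ResolventBoundedOn A ω) :
    0 < rOf A ω := by
  refine inv_pos.2 ?_
  have hz : ω < ((ω + 1 : ℝ) : ℂ).re := by simp
  refine lt_of_lt_of_le (norm_pos_iff.2 fun h0 => ?_) (norm_resolventOf_le_sSup h hz)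
  have := resolventOf_spec (h.1 _ hz.le)
  rw [h0] at this
  exact not_subsingleton H this.subsingleton

theorem norm_le_of_rOf [CompleteSpace H] [Nontrivial H] {S : ℝ → H →L[ℂ] H} (hS : IsC0Semigroup S)
    {ω : ℝ} (hres : ResolventBoundedOn (generator S) ω)
    {m : ℝ → ℝ} (hm_cont : ContinuousOn m (Ici 0)) (hm_pos : ∀ t : ℝ, 0 ≤ t → 0 < m t)
    (hm : ∀ t : ℝ, 0 ≤ t → ‖S t‖ ≤ m t) {a b t : ℝ} (ha : 0 < a) (hb : 0 < b) (hab : a + b ≤ t) :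
    ‖S t‖ ≤ Real.exp (ω * t - rOf (generator S) ω * (t - a - b)) /
      (rOf (generator S) ω * weightedL2Norm ω a (fun s => 1 / m s) *
        weightedL2Norm ω b (fun s => 1 / m s)) :=
  norm_le_of_resolvent_bound hS (inv_pos.1 (rOf_pos hres)) (fun z h => hres.1 z h.le)
    (fun _ h => norm_resolventOf_le_sSup hres h) hm_cont hm_pos hm ha hb hab

theorem weightedL2Norm_zero_one_sq {m : ℝ → ℝ} (hm_cont : ContinuousOn m (Ici 0))
    (hm1 : ∀ t : ℝ, 0 ≤ t → m t = 1) {a : ℝ} (ha : 0 ≤ a) :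
    weightedL2Norm 0 a (fun s => 1 / m s) ^ 2 = a := by
  rw [weightedL2Norm_sq hm_cont (fun t ht => by rw [hm1 t ht]; exact one_pos) ha]
  have : weightDensity 0 m = fun _ => 1 := by
    funext s
    simp [weightDensity, hm1 _ (le_max_right s 0)]
  simp [this]

end SemigroupBounds

end

theorem theorem1p7 {H : Type*} [NormedAddCommGroup H] [InnerProductSpace ℂ H] [CompleteSpace H]
    (S : ℝ → H →L[ℂ] H) (hS : SemigroupBounds.IsC0Semigroup S)
    (ω : ℝ)
    (hres : SemigroupBounds.ResolventBoundedOn (SemigroupBounds.generator S) ω)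
    (m : ℝ → ℝ) (hm_cont : ContinuousOn m (Set.Ici 0))
    (hm_pos : ∀ t : ℝ, 0 ≤ t → 0 < m t)
    (hm : ∀ t : ℝ, 0 ≤ t → ‖S t‖ ≤ m t) :
    (∀ a b t : ℝ, 0 < a → 0 < b → a + b < t →
      ‖S t‖ ≤
        Real.exp (ω * t - SemigroupBounds.rOf (SemigroupBounds.generator S) ω * (t - a - b)) /
          (SemigroupBounds.rOf (SemigroupBounds.generator S) ω *
            SemigroupBounds.weightedL2Norm ω a (fun s => 1 / m s) *
            SemigroupBounds.weightedL2Norm ω b (fun s => 1 / m s))) ∧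
    (ω = 0 → (∀ t : ℝ, 0 ≤ t → m t = 1) →
      ∀ t : ℝ, 0 ≤ t →
        ‖S t‖ ≤ 2 * Real.exp 1 *
          Real.exp (-(SemigroupBounds.rOf (SemigroupBounds.generator S) 0 * t))) := by
  -- On the zero space all resolvents vanish and `rOf` is `0⁻¹ = 0`, so this degenerate case is
  -- separated; there `‖S t‖ = 0`.
  rcases subsingleton_or_nontrivial H with hH | hH
  · have h0 : ∀ t, ‖S t‖ = 0 := fun t => by
      rw [Subsingleton.elim (S t) 0, norm_zero]
    refine ⟨fun a b t _ _ _ => ?_, fun _ _ t _ => ?_⟩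
    · rw [h0]
      exact div_nonneg (Real.exp_pos _).le (mul_nonneg (mul_nonneg
        (SemigroupBounds.rOf_nonneg _ _) ENNReal.toReal_nonneg) ENNReal.toReal_nonneg)
    · rw [h0]; positivity
  refine ⟨fun a b t ha hb hab =>
    SemigroupBounds.norm_le_of_rOf hS hres hm_cont hm_pos hm ha hb hab.le, ?_⟩
  rintro rfl hm1 t ht
  have hr := SemigroupBounds.rOf_pos hres
  set r := SemigroupBounds.rOf (SemigroupBounds.generator S) 0 with hrdef
  rw [mul_assoc, ← Real.exp_add]
  -- For `rt ≤ 1` contractivity suffices, as `1 ≤ e^{1-rt}`. Otherwise `a = b = 1/(2r)`, the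
  -- minimizer of `e^{r(a+b)}/(r√(ab))`, gives the constant `2e`; equality `a + b = t` is allowed in
  -- `norm_le_of_rOf`.
  rcases le_total (r * t) 1 with h | h
  · have h1 : ‖S t‖ ≤ 1 := (hm t ht).trans_eq (hm1 t ht)
    have h2 : 1 ≤ Real.exp (1 + -(r * t)) := Real.one_le_exp (by linarith)
    linarith
  · have ha : 0 < 1 / (2 * r) := by positivity
    have hat : 1 / (2 * r) + 1 / (2 * r) ≤ t := by
      rw [← two_mul, mul_one_div, div_le_iff₀ (by positivity)]; linarith
    have key := SemigroupBounds.norm_le_of_rOf hS hres hm_cont hm_pos hm ha ha hat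
    rw [← hrdef, mul_assoc, ← sq, SemigroupBounds.weightedL2Norm_zero_one_sq hm_cont hm1 ha.le] at key
    refine key.trans_eq ?_
    rw [show r * (1 / (2 * r)) = 1 / 2 by field_simp,
      show 0 * t - r * (t - 1 / (2 * r) - 1 / (2 * r)) = 1 + -(r * t) by field_simp; ring]
    ring
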